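/- Corollary. Let $B_j=B_j(0)$ be the Bernoulli numbers (so $B_1=-\tfrac12$) and let $\left[{k\atop n}\right]$ be the unsigned Stirling numbers of the first kind. Say that a real series $\sum_{k\ge m}t_k$, convergent or not, is semi-convergent with value $S$ if, for every $N\ge m$, the error $R_N=S-\sum_{m\le k<N}t_k$ does not exceed in absolute value the first nonzero term among $t_N,t_{N+1},\dots$ (and $R_N=0$ if all these are zero), and if moreover, whenever at least one of the retained terms $t_m,\dots,t_{N-1}$ is nonzero, $R_N$ is either zero or of the same sign as that first nonzero neglected term. The Riemann zeta function has an expansion $$\zeta(s)=\sum_{n=0}^{\infty}\zeta_n s^n,\qquad |s|<1,$$ and for every $n\ge 0$ its coefficient $\zeta_n$ is real and is represented by the semi-convergent series $$\zeta_n=-1+\sum_{k=n}^{\infty}(-1)^{k+1}\left[{k\atop n}\right]\frac{B_{k+1}}{(k+1)!},$$ that is, the series on the right is semi-convergent, in the above sense, with value $\zeta_n+1$. -/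

import Mathlib

/-- `ζ(s) = ∑ cₙ sⁿ` on the open unit disc. -/
def IsZetaMaclaurin (c : ℕ → ℂ) : Prop :=
  ∀ s : ℂ, ‖s‖ < 1 → HasSum (fun n : ℕ => c n * s ^ n) (riemannZeta s)

/-- The series `∑_{k ≥ m} t k` is semi-convergent with value `S`: whenever it is stopped
(just before the index `N`), the error `S - ∑_{m ≤ k < N} t k` does not exceed in absolute
value the first nonzero term neglected, and, as soon as at least one nonzero term has been
retained, the error also has the sign of that term. (The index `M` is that of the first nonzero
term neglected. If some zero term can serve as `t M`, for instance because no nonzero term is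
left, then the error is required to be zero.) No convergence of the series is involved. -/
def SemiconvergesTo (t : ℕ → ℝ) (m : ℕ) (S : ℝ) : Prop :=
  ∀ N : ℕ, m ≤ N → ∃ M : ℕ, N ≤ M ∧ (∀ k ∈ Finset.Ico N M, t k = 0) ∧
    |S - ∑ k ∈ Finset.Ico m N, t k| ≤ |t M| ∧
    ((∃ k ∈ Finset.Ico m N, t k ≠ 0) →
      ∃ θ ∈ Set.Icc (0 : ℝ) 1, S - ∑ k ∈ Finset.Ico m N, t k = θ * t M)

/-- The term `(-1)^(k+1) [k n] B_{k+1} / (k+1)!`, with `[k n]` the unsigned Stirling number of the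
first kind and `B_j = B_j(0)` the Bernoulli number (so `B_1 = -1/2`). -/
noncomputable def zetaTerm (n k : ℕ) : ℝ :=
  (-1) ^ (k + 1) * (Nat.stirlingFirst k n : ℝ) * (bernoulli (k + 1) : ℝ) /
    (Nat.factorial (k + 1) : ℝ)

/-! Hermite's formula gives `ζ(s) = 1/(s-1) + 1/2 + 2 ∫ Im (1-it)^(-s) w(t) dt` over `t > 0`, with
`w(t) = 1/(e^(2πt)-1)`. Expanding `(1-it)^(-s)` in powers of `s` produces `logPow n t`, and
`1/(s-1)` contributes the constant `-1` to every Maclaurin coefficient; the summand `1/2` only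
affects `n = 0`.

Expand `logPow n` in turn in powers of `it`. The coefficients are `[k n]/k!`, and the odd moments of
`w` are Bernoulli numbers (`integral_pow_mul_planaWeight`), so term-by-term integration gives
exactly the stated series. It need not converge, but on the imaginary axis the Taylor remainder is
at most the first neglected term in modulus (`norm_logPowRem_le`). Integrating against `w ≥ 0`
preserves this bound (`abs_zetaCoeff_sub_sum_le`).

The sign needs no further analysis: consecutive odd-index terms have opposite signs, and bounding
two consecutive errors by their first neglected terms forces the later error to lie between `0` and
its own term (`exists_mem_Icc_eq_mul`). -/

open MeasureTheory Set Filter Topology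

/-! ### Taylor remainders of `(-log (1-z))ⁿ / n!` on the imaginary axis -/

/-- The function `(-log (1 - z))ⁿ / n!`, the exponential generating function of the unsigned
Stirling numbers `[k n]`, at the point `z = it` of the imaginary axis. -/
noncomputable def logPow (n : ℕ) (t : ℝ) : ℂ :=
  (-Complex.log (1 - t * Complex.I)) ^ n / (n.factorial : ℂ)

/-- The Taylor coefficient `[k n] / k!`. -/
noncomputable def stirlingCoeff (n k : ℕ) : ℝ := (Nat.stirlingFirst k n : ℝ) / (k.factorial : ℝ)

lemma stirlingCoeff_nonneg (n k : ℕ) : 0 ≤ stirlingCoeff n k := by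
  unfold stirlingCoeff; positivity

lemma stirlingCoeff_eq_zero {n k : ℕ} (h : k < n) : stirlingCoeff n k = 0 := by
  simp [stirlingCoeff, Nat.stirlingFirst_eq_zero_of_lt h]

/-- Coefficient form of `(1-z) f' = g`, where `f` and `g` are the generating functions of orders `n
+ 1` and `n`. -/
lemma succ_mul_stirlingCoeff_succ (n M : ℕ) :
    (M + 1 : ℝ) * stirlingCoeff (n + 1) (M + 1)
      = M * stirlingCoeff (n + 1) M + stirlingCoeff n M := by
  unfold stirlingCoeff
  rw [Nat.stirlingFirst_succ_succ, Nat.factorial_succ]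
  push_cast
  field_simp

lemma one_sub_mul_I_mem_slitPlane (t : ℝ) : 1 - (t : ℂ) * Complex.I ∈ Complex.slitPlane :=
  Or.inl (by simp)

lemma one_sub_mul_I_ne_zero (t : ℝ) : 1 - (t : ℂ) * Complex.I ≠ 0 :=
  Complex.slitPlane_ne_zero (one_sub_mul_I_mem_slitPlane t)

lemma one_le_norm_one_sub_mul_I (t : ℝ) : 1 ≤ ‖1 - (t : ℂ) * Complex.I‖ := by
  simpa using Complex.abs_re_le_norm (1 - (t : ℂ) * Complex.I)

lemma hasDerivAt_logPow (n : ℕ) (t : ℝ) :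
    HasDerivAt (logPow (n + 1)) (Complex.I * logPow n t / (1 - t * Complex.I)) t := by
  have h1 : HasDerivAt (fun t : ℝ => 1 - (t : ℂ) * Complex.I) (-Complex.I) t := by
    simpa using ((Complex.ofRealCLM.hasDerivAt (x := t)).mul_const Complex.I).const_sub 1
  have h2 := (((h1.clog_real (one_sub_mul_I_mem_slitPlane t)).fun_neg).fun_pow (n + 1)).div_const
    (((n + 1).factorial : ℕ) : ℂ)
  refine h2.congr_deriv ?_
  have := one_sub_mul_I_ne_zero t
  rw [logPow, Nat.factorial_succ]
  have h3 : ((n.factorial : ℕ) : ℂ) ≠ 0 := by exact_mod_cast n.factorial_ne_zero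
  have h4 : (n + 1 : ℂ) ≠ 0 := by exact_mod_cast n.succ_ne_zero
  push_cast
  field_simp

lemma continuous_logPow (n : ℕ) : Continuous (logPow n) := by
  unfold logPow
  refine Continuous.div_const (Continuous.pow (Continuous.neg ?_) _) _
  exact Continuous.clog (by fun_prop) one_sub_mul_I_mem_slitPlane

lemma logPow_succ_zero (n : ℕ) : logPow (n + 1) 0 = 0 := by simp [logPow]

/-- Taylor remainder of `(-log (1 - z))ⁿ / n!` at `z = it`. -/
noncomputable def logPowRem (n M : ℕ) (t : ℝ) : ℂ :=
  logPow n t - ∑ k ∈ Finset.range M, (stirlingCoeff n k : ℂ) * (t * Complex.I) ^ k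

/-- The derivative of the remainder, in terms of the remainder of lower order. -/
lemma hasDerivAt_logPowRem (n M : ℕ) (t : ℝ) :
    HasDerivAt (logPowRem (n + 1) (M + 1))
      (Complex.I * (logPowRem n M t
        + (M * stirlingCoeff (n + 1) M : ℝ) * (t * Complex.I) ^ M) / (1 - t * Complex.I)) t := by
  have h1 : HasDerivAt (fun t : ℝ => (t : ℂ) * Complex.I) Complex.I t := by
    simpa using (Complex.ofRealCLM.hasDerivAt (x := t)).mul_const Complex.I
  have h2 : HasDerivAt (fun t : ℝ => ∑ k ∈ Finset.range (M + 1),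
      (stirlingCoeff (n + 1) k : ℂ) * (t * Complex.I) ^ k)
      (∑ k ∈ Finset.range (M + 1),
        (stirlingCoeff (n + 1) k : ℂ) * (k * (t * Complex.I) ^ (k - 1) * Complex.I)) t :=
    HasDerivAt.fun_sum fun k _ => (h1.fun_pow k).const_mul _
  refine ((hasDerivAt_logPow n t).fun_sub h2).congr_deriv ?_
  -- Multiplying by `1 - it` telescopes through the Stirling recurrence; only the top-degree term `M
  -- * stirlingCoeff (n + 1) M` is left over.
  have key : ∀ M : ℕ, (∑ k ∈ Finset.range (M + 1),
        (stirlingCoeff (n + 1) k : ℂ) * (k * (t * Complex.I) ^ (k - 1) * Complex.I))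
          * (1 - t * Complex.I)
      = Complex.I * (∑ k ∈ Finset.range M, (stirlingCoeff n k : ℂ) * (t * Complex.I) ^ k
        - (M * stirlingCoeff (n + 1) M : ℝ) * (t * Complex.I) ^ M) := by
    intro M
    induction M with
    | zero => simp
    | succ M ih =>
      rw [Finset.sum_range_succ, add_mul, ih, Finset.sum_range_succ]
      have h := congrArg (fun x : ℝ => (x : ℂ)) (succ_mul_stirlingCoeff_succ n M)
      push_cast at h ⊢
      rw [pow_succ]
      linear_combination (Complex.I * (t * Complex.I) ^ M) * h
  have hne := one_sub_mul_I_ne_zero t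
  rw [logPowRem, eq_div_iff hne, sub_mul, key M, div_mul_cancel₀ _ hne]
  ring

/-- Induction on `n` by comparing derivatives. Since `|1-it| ≥ 1`, the denominator can be dropped;
the two remaining pieces of the derivative then have bounds adding up, by the Stirling recurrence,
to exactly the derivative of the claimed bound. Hence no constant is lost. -/
lemma norm_logPowRem_le {n M : ℕ} (h : n ≤ M) {t : ℝ} (ht : 0 ≤ t) :
    ‖logPowRem n M t‖ ≤ stirlingCoeff n M * t ^ M := by
  induction n generalizing M t with
  | zero =>
    cases M with
    | zero => simp [logPowRem, logPow, stirlingCoeff]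
    | succ M =>
      have : logPowRem 0 (M + 1) t = 0 := by
        rw [logPowRem, Finset.sum_range_succ', Finset.sum_eq_zero]
        · simp [logPow, stirlingCoeff]
        · intro k _
          simp [stirlingCoeff]
      rw [this, norm_zero]
      exact mul_nonneg (stirlingCoeff_nonneg _ _) (pow_nonneg ht _)
  | succ n ih =>
    obtain ⟨M, rfl⟩ : ∃ K, M = K + 1 := ⟨M - 1, by omega⟩
    have hB : ∀ x : ℝ, HasDerivAt (fun x : ℝ => stirlingCoeff (n + 1) (M + 1) * x ^ (M + 1))
        (stirlingCoeff (n + 1) (M + 1) * ((M + 1 : ℕ) * x ^ M)) x := fun x =>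
      ((hasDerivAt_pow (M + 1) x).const_mul _)
    refine image_norm_le_of_norm_deriv_right_le_deriv_boundary (a := 0) (b := t)
      (fun x _ => (hasDerivAt_logPowRem n M x).continuousAt.continuousWithinAt)
      (fun x _ => (hasDerivAt_logPowRem n M x).hasDerivWithinAt) ?_ hB ?_ ⟨ht, le_rfl⟩
    · have : logPowRem (n + 1) (M + 1) 0 = 0 := by
        rw [logPowRem, Finset.sum_range_succ', Finset.sum_eq_zero]
        · simp [logPow_succ_zero, stirlingCoeff_eq_zero]
        · intro k _; simp
      simp [this]
    · rintro x ⟨hx, -⟩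
      rw [norm_div, norm_mul, Complex.norm_I, one_mul]
      refine (div_le_self (norm_nonneg _) (one_le_norm_one_sub_mul_I x)).trans ?_
      refine (norm_add_le _ _).trans ?_
      have h1 := ih (M := M) (by omega) hx
      have h2 : ‖((M * stirlingCoeff (n + 1) M : ℝ) : ℂ) * (x * Complex.I) ^ M‖
          = M * stirlingCoeff (n + 1) M * x ^ M := by
        rw [norm_mul, Complex.norm_real, norm_pow, norm_mul (x : ℂ), Complex.norm_I, mul_one,
          Complex.norm_real, Real.norm_of_nonneg hx, Real.norm_of_nonneg]
        exact mul_nonneg M.cast_nonneg (stirlingCoeff_nonneg _ _)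
      rw [h2]
      have h3 := succ_mul_stirlingCoeff_succ n M
      push_cast
      calc _ ≤ stirlingCoeff n M * x ^ M + M * stirlingCoeff (n + 1) M * x ^ M := by gcongr
        _ = _ := by linear_combination (-x ^ M) * h3

lemma norm_logPow_le (n : ℕ) {t : ℝ} (ht : 0 ≤ t) :
    ‖logPow n t‖ ≤ t ^ n / n.factorial := by
  have h := norm_logPowRem_le (le_refl n) ht
  have h0 : logPowRem n n t = logPow n t := by
    rw [logPowRem, Finset.sum_eq_zero, sub_zero]
    intro k hk
    simp [stirlingCoeff_eq_zero (Finset.mem_range.1 hk)]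
  rwa [h0, stirlingCoeff, Nat.stirlingFirst_self, Nat.cast_one, one_div_mul_eq_div] at h

lemma continuous_logPowRem (n M : ℕ) : Continuous (logPowRem n M) := by
  have := continuous_logPow n
  unfold logPowRem
  fun_prop

lemma logPow_zero (t : ℝ) : logPow 0 t = 1 := by simp [logPow]

lemma hasSum_logPow (t : ℝ) (s : ℂ) :
    HasSum (fun n => logPow n t * s ^ n) ((1 - t * Complex.I) ^ (-s)) := by
  rw [Complex.cpow_def_of_ne_zero (one_sub_mul_I_ne_zero t)]
  have := NormedSpace.expSeries_div_hasSum_exp (𝔸 := ℂ) (Complex.log (1 - t * Complex.I) * -s)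
  rw [← Complex.exp_eq_exp_ℂ] at this
  refine this.congr_fun fun n => ?_
  rw [logPow, mul_neg, ← neg_mul, mul_pow]
  ring

/-! ### The weight and its moments -/

/-- The weight `1 / (e^{2πt} - 1)`. -/
noncomputable def planaWeight (t : ℝ) : ℝ := (Real.exp (2 * Real.pi * t) - 1)⁻¹

lemma exp_two_pi_mul_sub_one_pos {t : ℝ} (ht : 0 < t) : 0 < Real.exp (2 * Real.pi * t) - 1 :=
  sub_pos.2 (Real.one_lt_exp_iff.2 (by positivity))

lemma planaWeight_nonneg {t : ℝ} (ht : 0 < t) : 0 ≤ planaWeight t :=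
  inv_nonneg.2 (exp_two_pi_mul_sub_one_pos ht).le

lemma measurable_planaWeight : Measurable planaWeight := by
  unfold planaWeight; fun_prop

/-- From `2π > 6` and `e^(3t) ≥ 1 + 3t`. The rate `3` later yields coefficients of size `O(3^(-n))`,
so that the power series converges beyond the pole at `s = 1`. -/
lemma mul_planaWeight_le {t : ℝ} (ht : 0 < t) : t * planaWeight t ≤ Real.exp (-(3 * t)) := by
  have h0 := exp_two_pi_mul_sub_one_pos ht
  rw [planaWeight, ← div_eq_mul_inv, div_le_iff₀ h0, Real.exp_neg, inv_mul_eq_div,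
    le_div_iff₀ (Real.exp_pos _)]
  have h1 : Real.exp (3 * t) * Real.exp (3 * t) ≤ Real.exp (2 * Real.pi * t) := by
    rw [← Real.exp_add]
    apply Real.exp_le_exp.2
    nlinarith [Real.pi_gt_three]
  have h2 := Real.add_one_le_exp (3 * t)
  nlinarith

lemma integrableOn_pow_mul_exp_neg (k : ℕ) :
    IntegrableOn (fun t : ℝ => t ^ k * Real.exp (-(3 * t))) (Ioi 0) := by
  have := integrableOn_rpow_mul_exp_neg_mul_rpow (p := 1) (s := k) (b := 3)
    (by have : (0 : ℝ) ≤ k := k.cast_nonneg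
        linarith) one_pos (by norm_num)
  simpa using this

lemma integral_pow_mul_exp_neg (k : ℕ) :
    ∫ t in Ioi (0 : ℝ), t ^ k * Real.exp (-(3 * t)) = k.factorial / 3 ^ (k + 1) := by
  have h := Real.integral_rpow_mul_exp_neg_mul_Ioi (a := k + 1) (r := 3) (by positivity)
    (by norm_num)
  rw [Real.Gamma_nat_eq_factorial] at h
  simp only [add_sub_cancel_right, Real.rpow_natCast] at h
  rw [h, ← Nat.cast_succ, Real.rpow_natCast]
  simp [div_eq_inv_mul]

lemma abs_mul_planaWeight_le {f : ℝ → ℝ} {k : ℕ} {C t : ℝ} (ht : 0 < t)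
    (hb : |f t| ≤ C * t ^ (k + 1)) :
    |f t * planaWeight t| ≤ C * (t ^ k * Real.exp (-(3 * t))) := by
  have hC : 0 ≤ C := by
    have h := (abs_nonneg _).trans hb
    exact nonneg_of_mul_nonneg_left h (by positivity)
  rw [abs_mul, abs_of_nonneg (planaWeight_nonneg ht)]
  calc |f t| * planaWeight t ≤ C * t ^ (k + 1) * planaWeight t :=
        mul_le_mul_of_nonneg_right hb (planaWeight_nonneg ht)
    _ = C * (t ^ k * (t * planaWeight t)) := by ring
    _ ≤ _ := by gcongr; exact mul_planaWeight_le ht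

lemma integrableOn_mul_planaWeight {f : ℝ → ℝ} (hf : Continuous f) {k : ℕ} {C : ℝ}
    (hb : ∀ t, 0 < t → |f t| ≤ C * t ^ (k + 1)) :
    IntegrableOn (fun t => f t * planaWeight t) (Ioi 0) := by
  refine Integrable.mono' ((integrableOn_pow_mul_exp_neg k).const_mul C)
    (hf.measurable.mul measurable_planaWeight).aestronglyMeasurable ?_
  filter_upwards [ae_restrict_mem measurableSet_Ioi] with t ht
  exact abs_mul_planaWeight_le ht (hb t ht)

lemma integral_abs_mul_planaWeight_le {f : ℝ → ℝ} (hf : Continuous f) {k : ℕ} {C : ℝ}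
    (hb : ∀ t, 0 < t → |f t| ≤ C * t ^ (k + 1)) :
    ∫ t in Ioi 0, |f t * planaWeight t| ≤ C * (k.factorial / 3 ^ (k + 1)) := by
  rw [← integral_pow_mul_exp_neg, ← integral_const_mul]
  refine setIntegral_mono_on (integrableOn_mul_planaWeight hf hb).abs
    ((integrableOn_pow_mul_exp_neg k).const_mul C) measurableSet_Ioi fun t ht => ?_
  exact abs_mul_planaWeight_le ht (hb t ht)

lemma integrableOn_pow_mul_planaWeight (k : ℕ) :
    IntegrableOn (fun t : ℝ => t ^ (k + 1) * planaWeight t) (Ioi 0) :=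
  integrableOn_mul_planaWeight (C := 1) (by fun_prop) fun t ht => by
    rw [abs_of_pos (by positivity), one_mul]

lemma abs_integral_mul_planaWeight_le {f : ℝ → ℝ} (hf : Continuous f) {k : ℕ} {C : ℝ}
    (hb : ∀ t, 0 < t → |f t| ≤ C * t ^ (k + 1)) :
    |∫ t in Ioi 0, f t * planaWeight t| ≤ C * ∫ t in Ioi 0, t ^ (k + 1) * planaWeight t := by
  refine (abs_integral_le_integral_abs).trans ?_
  rw [← integral_const_mul]
  refine setIntegral_mono_on (integrableOn_mul_planaWeight hf hb).abs
    ((integrableOn_pow_mul_planaWeight k).const_mul C) measurableSet_Ioi fun t ht => ?_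
  rw [abs_mul, abs_of_nonneg (planaWeight_nonneg ht), ← mul_assoc]
  exact mul_le_mul_of_nonneg_right (hb t ht) (planaWeight_nonneg ht)

lemma hasSum_exp_neg_mul {y : ℝ} (hy : 0 < y) :
    HasSum (fun i : ℕ => Real.exp (-((i + 1) * y))) (Real.exp y - 1)⁻¹ := by
  have h := (hasSum_geometric_of_lt_one (Real.exp_nonneg (-y))
    (by simpa using hy)).mul_left (Real.exp (-y))
  have h1 : 0 < Real.exp y - 1 := sub_pos.2 (Real.one_lt_exp_iff.2 hy)
  convert! h using 1
  · funext i
    rw [← Real.exp_nat_mul, ← Real.exp_add]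
    congr 1; ring
  · rw [Real.exp_neg, ← mul_inv, mul_sub, mul_inv_cancel₀ (Real.exp_pos y).ne', mul_one]

lemma hasSum_planaWeight {t : ℝ} (ht : 0 < t) :
    HasSum (fun i : ℕ => Real.exp (-(2 * Real.pi * (i + 1)) * t)) (planaWeight t) :=
  (hasSum_exp_neg_mul (y := 2 * Real.pi * t) (by positivity)).congr_fun fun i => by
    congr 1; ring

/-- Integrating the geometric series of the weight termwise gives `Γ(2m) ζ(2m) / (2π)^(2m)`, which
Euler's evaluation of `ζ(2m)` turns into a Bernoulli number. -/
lemma integral_pow_mul_planaWeight {m : ℕ} (hm : m ≠ 0) :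
    ∫ t in Ioi (0 : ℝ), t ^ (2 * m - 1) * planaWeight t
      = (-1) ^ (m + 1) * bernoulli (2 * m) / (4 * m) := by
  have hz := hasSum_zeta_nat hm
  rw [← hasSum_nat_add_iff' 1] at hz
  simp only [Finset.range_one, Finset.sum_singleton] at hz
  have h0 : (1 : ℝ) / ((0 : ℕ) : ℝ) ^ (2 * m) = 0 := by simp [hm]
  rw [h0, sub_zero] at hz
  have hz' : HasSum (fun n : ℕ => 1 / (2 * Real.pi * (n + 1)) ^ (2 * m))
      ((-1) ^ (m + 1) * bernoulli (2 * m) / (2 * (2 * m).factorial : ℝ)) := by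
    convert! hz.mul_left (1 / (2 * Real.pi) ^ (2 * m)) using 1
    · funext n
      push_cast
      rw [mul_pow (2 * Real.pi)]
      field_simp
    · rw [mul_pow, ← pow_sub_one_mul (by omega : 2 * m ≠ 0) (2 : ℝ)]
      have := Real.pi_ne_zero
      field_simp
  have h := hasSum_mellin (a := fun _ : ℕ => (1 : ℂ)) (p := fun i => 2 * Real.pi * (i + 1))
    (F := fun t => (planaWeight t : ℂ)) (s := ((2 * m : ℕ) : ℂ))
    (fun i => Or.inr (by positivity)) (by rw [Complex.natCast_re]; positivity)
    (fun t ht => by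
      simpa using (Complex.hasSum_ofReal.2 (hasSum_planaWeight ht)))
    (by simpa [-Nat.cast_mul, Real.rpow_natCast] using hz'.summable)
  have hG : Complex.Gamma ((2 * m : ℕ) : ℂ) = ((2 * m - 1).factorial : ℂ) := by
    obtain ⟨j, hj⟩ : ∃ j, 2 * m = j + 1 := ⟨2 * m - 1, by omega⟩
    rw [hj, Nat.cast_succ, Complex.Gamma_nat_eq_factorial]; simp
  have h2 : mellin (fun t => (planaWeight t : ℂ)) ((2 * m : ℕ) : ℂ)
      = ((∫ t in Ioi (0 : ℝ), t ^ (2 * m - 1) * planaWeight t : ℝ) : ℂ) := by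
    rw [mellin, ← integral_complex_ofReal]
    refine setIntegral_congr_fun measurableSet_Ioi fun t _ => ?_
    have : ((2 * m : ℕ) : ℂ) - 1 = ((2 * m - 1 : ℕ) : ℂ) := by
      rw [Nat.cast_sub (by omega)]; simp
    simp only [this, Complex.cpow_natCast, smul_eq_mul]
    push_cast; rfl
  have h3 : HasSum (fun n : ℕ => ((((2 * m - 1).factorial : ℝ) *
      (1 / (2 * Real.pi * (n + 1)) ^ (2 * m)) : ℝ) : ℂ))
      ((∫ t in Ioi (0 : ℝ), t ^ (2 * m - 1) * planaWeight t : ℝ) : ℂ) := by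
    rw [← h2]
    convert! h using 2 with n
    rw [hG, Complex.cpow_natCast]
    push_cast
    ring
  rw [(Complex.hasSum_ofReal.1 h3).unique (hz'.mul_left _),
    ← Nat.mul_factorial_pred (by omega : 2 * m ≠ 0)]
  push_cast
  have : ((2 * m - 1).factorial : ℝ) ≠ 0 := by exact_mod_cast Nat.factorial_ne_zero _
  have : (m : ℝ) ≠ 0 := by exact_mod_cast hm
  field_simp
  ring

/-! ### Legendre's integral -/

lemma integral_sin_mul_exp_neg (x : ℝ) {a : ℝ} (ha : 0 < a) :
    ∫ t in Ioi (0 : ℝ), Real.sin (x * t) * Real.exp (-a * t) = x / (x ^ 2 + a ^ 2) := by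
  have hre : (-(a : ℂ) + x * Complex.I).re < 0 := by simpa using ha
  have h := integral_exp_mul_complex_Ioi hre 0
  have h1 := integral_im (integrableOn_exp_mul_complex_Ioi hre 0)
  rw [h] at h1
  have h2 : ∀ t : ℝ, (Complex.exp ((-(a : ℂ) + x * Complex.I) * t)).im
      = Real.sin (x * t) * Real.exp (-a * t) := by
    intro t
    rw [Complex.exp_im]
    simp [mul_comm]
  simp only [RCLike.im_to_complex, h2] at h1
  rw [h1]
  simp [Complex.div_im, Complex.normSq_apply]
  ring

lemma hasSum_sin_integral {x : ℝ} (hx : 0 < x) :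
    HasSum (fun i : ℕ => x / (x ^ 2 + (2 * Real.pi * (i + 1)) ^ 2))
      (∫ t in Ioi (0 : ℝ), Real.sin (x * t) * planaWeight t) := by
  have hint : ∀ i : ℕ, IntegrableOn
      (fun t : ℝ => t * Real.exp (-(2 * Real.pi * (i + 1)) * t)) (Ioi 0) := fun i => by
    have := integrableOn_rpow_mul_exp_neg_mul_rpow (p := 1) (s := 1)
      (b := 2 * Real.pi * (i + 1)) (by norm_num) one_pos (by positivity)
    simpa using this
  have hval : ∀ i : ℕ, ∫ t in Ioi (0 : ℝ), t * Real.exp (-(2 * Real.pi * (i + 1)) * t)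
      = (1 / (2 * Real.pi * (i + 1))) ^ 2 := fun i => by
    have := Real.integral_rpow_mul_exp_neg_mul_Ioi (a := 2) (r := 2 * Real.pi * (i + 1))
      (by norm_num) (by positivity)
    rw [show (2 : ℝ) - 1 = 1 by norm_num, Real.Gamma_two, mul_one] at this
    simp only [Real.rpow_one, Real.rpow_two] at this
    rw [← this]
    simp only [neg_mul]
  have hbd : ∀ (i : ℕ) (t : ℝ), 0 < t →
      ‖Real.sin (x * t) * Real.exp (-(2 * Real.pi * (i + 1)) * t)‖
        ≤ x * (t * Real.exp (-(2 * Real.pi * (i + 1)) * t)) := fun i t ht => by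
    rw [norm_mul, Real.norm_of_nonneg (Real.exp_nonneg _), ← mul_assoc]
    gcongr
    rw [Real.norm_eq_abs]
    exact Real.abs_sin_le_abs.trans (abs_of_pos (by positivity)).le
  have hI : ∀ i : ℕ, IntegrableOn
      (fun t : ℝ => Real.sin (x * t) * Real.exp (-(2 * Real.pi * (i + 1)) * t)) (Ioi 0) :=
    fun i => by
      refine Integrable.mono' ((hint i).const_mul x)
        (Continuous.aestronglyMeasurable (by fun_prop)) ?_
      filter_upwards [ae_restrict_mem measurableSet_Ioi] with t ht using hbd i t ht
  have h := hasSum_integral_of_summable_integral_norm hI ?_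
  · have hv : ∀ i : ℕ, 0 < 2 * Real.pi * ((i : ℝ) + 1) := fun i => by positivity
    simp only [integral_sin_mul_exp_neg x (hv _)] at h
    convert! h using 1
    refine setIntegral_congr_fun measurableSet_Ioi fun t ht => ?_
    exact ((hasSum_planaWeight ht).mul_left _).tsum_eq.symm
  · refine Summable.of_nonneg_of_le (fun i => integral_nonneg fun t => norm_nonneg _)
      (fun i => ?_) (f := fun i : ℕ => x * (1 / (2 * Real.pi * (i + 1))) ^ 2) ?_
    · rw [← hval, ← integral_const_mul]
      exact setIntegral_mono_on (hI i).norm ((hint i).const_mul x) measurableSet_Ioi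
        fun t ht => hbd i t ht
    · have h2 := (summable_nat_add_iff 1).2 (Real.summable_one_div_nat_pow.2 one_lt_two)
      refine (h2.mul_left (x * (1 / (2 * Real.pi)) ^ 2)).congr fun i => ?_
      push_cast
      field_simp

/-- Legendre's integral. -/
lemma two_mul_integral_sin_mul_planaWeight {x : ℝ} (hx : 0 < x) :
    2 * ∫ t in Ioi (0 : ℝ), Real.sin (x * t) * planaWeight t
      = (Real.exp x - 1)⁻¹ - x⁻¹ + 2⁻¹ := by
  have hpi : (Real.pi : ℂ) ≠ 0 := by exact_mod_cast Real.pi_ne_zero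
  have hxc : (x : ℂ) ≠ 0 := by exact_mod_cast hx.ne'
  -- At this point the partial fractions of `π cot πz` become the series of `hasSum_sin_integral`,
  -- and `e^(2πiz) = e^(-x)`.
  set z : ℂ := Complex.I * x / (2 * Real.pi) with hz
  have hzim : z.im = x / (2 * Real.pi) := by
    have : z = ((x / (2 * Real.pi) : ℝ) : ℂ) * Complex.I := by
      rw [hz]; push_cast; ring
    rw [this, Complex.im_ofReal_mul]
    simp
  have hmem : z ∈ Complex.integerComplement := by
    rintro ⟨n, hn⟩
    have : z.im = 0 := by rw [← hn]; simp
    rw [hzim] at this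
    exact (div_pos hx (by positivity)).ne' this
  have h := cot_series_rep' hmem
  have he : 2 * Real.pi * Complex.I * z = ((-x : ℝ) : ℂ) := by
    rw [hz]; push_cast; field_simp; rw [Complex.I_sq]
  rw [Complex.cot_pi_eq_exp_ratio, he, ← Complex.ofReal_exp] at h
  have hs := Complex.hasSum_ofReal.2 ((hasSum_sin_integral hx).mul_left 2)
  have ht : ∀ n : ℕ, 1 / (z - (n + 1)) + 1 / (z + (n + 1))
      = (-2 * Real.pi * Complex.I) *
        ((2 * (x / (x ^ 2 + (2 * Real.pi * (n + 1)) ^ 2)) : ℝ) : ℂ) := by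
    intro n
    have h1 : z - (n + 1) ≠ 0 := fun h0 => by
      have := congrArg Complex.im h0
      simp [hzim] at this
      exact hx.ne' this
    have h2 : z + (n + 1) ≠ 0 := fun h0 => by
      have := congrArg Complex.im h0
      simp [hzim] at this
      exact hx.ne' this
    have h3 : ((x : ℂ) ^ 2 + (2 * Real.pi * (n + 1)) ^ 2) ≠ 0 := by
      have : (0 : ℝ) < x ^ 2 + (2 * Real.pi * (n + 1)) ^ 2 := by positivity
      exact_mod_cast this.ne'
    have h4 : (x : ℂ) ^ 2 + (2 * Real.pi * (n + 1)) ^ 2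
        = -(2 * Real.pi) ^ 2 * ((z - (n + 1)) * (z + (n + 1))) := by
      rw [hz]; field_simp; ring_nf; rw [Complex.I_sq]; ring
    push_cast
    rw [h4, div_add_div _ _ h1 h2]
    have h5 : (x : ℂ) = -(2 * Real.pi) * Complex.I * z := by
      rw [hz]; field_simp; rw [Complex.I_sq]; ring
    rw [h5]
    field_simp
    rw [Complex.I_sq]
    ring
  simp only [ht] at h
  rw [tsum_mul_left, hs.tsum_eq] at h
  have hE : Real.exp x - 1 ≠ 0 := (sub_pos.2 (Real.one_lt_exp_iff.2 hx)).ne'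
  have hE' : (Real.exp x : ℂ) - 1 ≠ 0 := by exact_mod_cast hE
  have hEx : (Real.exp x : ℂ) ≠ 0 := by exact_mod_cast (Real.exp_pos x).ne'
  apply Complex.ofReal_injective
  have hne : (-2 * Real.pi * Complex.I : ℂ) ≠ 0 := by simp [hpi]
  apply mul_left_cancel₀ hne
  rw [← h, Real.exp_neg, hz]
  have h6 : 1 - (Real.exp x : ℂ)⁻¹ ≠ 0 := by
    rw [← inv_mul_cancel₀ hEx, ← mul_sub_one]
    exact mul_ne_zero (inv_ne_zero hEx) hE'
  rw [Complex.ofReal_inv]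
  push_cast at *
  field_simp
  ring_nf
  simp only [Complex.I_sq]
  ring

/-! ### Hermite's formula for real `s > 1` -/

lemma integrableOn_rpow_mul_exp_neg {s : ℝ} (hs : 0 < s) {b : ℝ} (hb : 0 < b) :
    IntegrableOn (fun x : ℝ => x ^ (s - 1) * Real.exp (-(b * x))) (Ioi 0) := by
  simpa using integrableOn_rpow_mul_exp_neg_mul_rpow (p := 1) (s := s - 1) (b := b)
    (by linarith) one_pos hb

/-- Euler's integral `∫ x^(s-1) e^(zx) dx = Γ(s) (-z)^(-s)` in the half plane `re z < 0`. -/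
lemma integral_rpow_mul_cexp {s : ℝ} (hs : 0 < s) {z : ℂ} (hz : z.re < 0) :
    ∫ x in Ioi (0 : ℝ), ((x ^ (s - 1) : ℝ) : ℂ) * Complex.exp (z * x)
      = Real.Gamma s * (-z) ^ (-(s : ℂ)) := by
  have hmeas : Measurable fun x : ℝ => ENNReal.ofReal (x ^ (s - 1)) := by fun_prop
  -- For the measure with density `x^(s-1)` on the half line, the integral is a complex moment
  -- generating function, hence analytic in `z`. It agrees with the right side on the negative
  -- reals, so the identity theorem applies on the half plane.
  set μ : Measure ℝ := (volume.restrict (Ioi 0)).withDensity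
    fun x => ENNReal.ofReal (x ^ (s - 1)) with hμ
  have hfin : ∀ᵐ x ∂(volume.restrict (Ioi (0 : ℝ))), ENNReal.ofReal (x ^ (s - 1)) < ⊤ :=
    Eventually.of_forall fun x => ENNReal.ofReal_lt_top
  have hM : ∀ z : ℂ, ProbabilityTheory.complexMGF id μ z
      = ∫ x in Ioi (0 : ℝ), ((x ^ (s - 1) : ℝ) : ℂ) * Complex.exp (z * x) := fun z => by
    rw [ProbabilityTheory.complexMGF, hμ, integral_withDensity_eq_integral_toReal_smul hmeas hfin]
    refine setIntegral_congr_fun measurableSet_Ioi fun x hx => ?_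
    simp only [id, ENNReal.toReal_ofReal (Real.rpow_nonneg (le_of_lt hx) _), Complex.real_smul]
  have hsub : Iio (0 : ℝ) ⊆ ProbabilityTheory.integrableExpSet id μ := fun u hu => by
    rw [ProbabilityTheory.integrableExpSet, mem_ofPred_eq, hμ,
      integrable_withDensity_iff_integrable_smul' hmeas hfin]
    refine (integrableOn_rpow_mul_exp_neg hs (neg_pos.2 hu)).congr_fun (fun x hx => ?_)
      measurableSet_Ioi
    simp only [id, ENNReal.toReal_ofReal (Real.rpow_nonneg (le_of_lt hx) _), smul_eq_mul,
      neg_mul, neg_neg]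
  have hU : ∀ z ∈ {z : ℂ | z.re < 0}, z.re ∈ interior (ProbabilityTheory.integrableExpSet id μ) :=
    fun z hz => interior_maximal hsub isOpen_Iio hz
  have hf : AnalyticOnNhd ℂ (ProbabilityTheory.complexMGF id μ) {z | z.re < 0} :=
    fun z hz => ProbabilityTheory.analyticAt_complexMGF (hU z hz)
  have hopen : IsOpen {z : ℂ | z.re < 0} := isOpen_lt Complex.continuous_re continuous_const
  have hg : AnalyticOnNhd ℂ (fun z : ℂ => Real.Gamma s * (-z) ^ (-(s : ℂ))) {z | z.re < 0} := by
    refine DifferentiableOn.analyticOnNhd (fun z hz => ?_) hopen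
    have hz' : -z ∈ Complex.slitPlane := Or.inl (by simpa using hz)
    exact (DifferentiableAt.const_mul
      (differentiableAt_id.neg.cpow_const hz') _).differentiableWithinAt
  have hpre : IsPreconnected {z : ℂ | z.re < 0} := (convex_halfSpace_re_lt 0).isPreconnected
  have hone : (-1 : ℂ) ∈ {z : ℂ | z.re < 0} := by simp
  have hreal : ∀ u : ℝ, u < 0 → ProbabilityTheory.complexMGF id μ u
      = Real.Gamma s * (-(u : ℂ)) ^ (-(s : ℂ)) := fun u hu => by
    have h := Complex.integral_cpow_mul_exp_neg_mul_Ioi (a := s) (r := -u) (by simpa) (by linarith)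
    rw [hM]
    have h2 : ((-u : ℝ) : ℂ) ≠ 0 := by exact_mod_cast (neg_pos.2 hu).ne'
    have h3 : (1 / ((-u : ℝ) : ℂ)) ^ (s : ℂ) = (-(u : ℂ)) ^ (-(s : ℂ)) := by
      rw [one_div, Complex.inv_cpow _ _
        (by rw [Complex.arg_ofReal_of_nonneg (by linarith)]; exact Real.pi_pos.ne),
        Complex.cpow_neg]
      push_cast; rfl
    rw [h3, Complex.Gamma_ofReal, mul_comm] at h
    rw [← h]
    refine setIntegral_congr_fun measurableSet_Ioi fun x hx => ?_
    rw [Complex.ofReal_cpow (le_of_lt hx)]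
    push_cast
    congr 2
    ring
  have hfreq : ∃ᶠ z in 𝓝[≠] (-1 : ℂ), ProbabilityTheory.complexMGF id μ z
      = Real.Gamma s * (-z) ^ (-(s : ℂ)) := by
    have ht : Tendsto (fun u : ℝ => (u : ℂ)) (𝓝[≠] (-1 : ℝ)) (𝓝[≠] (-1 : ℂ)) := by
      refine tendsto_nhdsWithin_iff.2 ⟨?_, ?_⟩
      · have := (Complex.continuous_ofReal.tendsto (-1 : ℝ)).mono_left
          (nhdsWithin_le_nhds (s := {-1}ᶜ))
        simpa using this
      · filter_upwards [self_mem_nhdsWithin] with u hu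
        intro h
        exact hu (Complex.ofReal_injective (by simpa using h))
    refine ht.frequently (Eventually.frequently ?_)
    filter_upwards [nhdsWithin_le_nhds (Iio_mem_nhds (show (-1 : ℝ) < 0 by norm_num))] with u hu
      using hreal u hu
  rw [← hM]
  exact hf.eqOn_of_preconnected_of_frequently_eq hg hpre hone hfreq hz

lemma integrableOn_rpow_mul_cexp {s : ℝ} (hs : 0 < s) {z : ℂ} (hz : z.re < 0) :
    IntegrableOn (fun x : ℝ => ((x ^ (s - 1) : ℝ) : ℂ) * Complex.exp (z * x)) (Ioi 0) := by
  refine Integrable.mono' (integrableOn_rpow_mul_exp_neg hs (neg_pos.2 hz))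
    (Measurable.aestronglyMeasurable (by fun_prop)) ?_
  filter_upwards [ae_restrict_mem measurableSet_Ioi] with x hx
  rw [norm_mul, Complex.norm_exp, Complex.norm_real,
    Real.norm_of_nonneg (Real.rpow_nonneg (le_of_lt hx) _)]
  simp

lemma integral_rpow_mul_exp_neg_mul_sin {s : ℝ} (hs : 0 < s) (t : ℝ) :
    ∫ x in Ioi (0 : ℝ), x ^ (s - 1) * Real.exp (-x) * Real.sin (x * t)
      = Real.Gamma s * ((1 - t * Complex.I) ^ (-(s : ℂ))).im := by
  have hz : (-1 + t * Complex.I).re < 0 := by simp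
  have h := integral_im (integrableOn_rpow_mul_cexp hs hz)
  rw [integral_rpow_mul_cexp hs hz] at h
  rw [show -(-1 + t * Complex.I) = 1 - t * Complex.I by ring] at h
  simp only [RCLike.im_to_complex, Complex.im_ofReal_mul] at h
  rw [← h]
  refine setIntegral_congr_fun measurableSet_Ioi fun x _ => ?_
  simp only [Complex.exp_im]
  simp [mul_assoc, mul_comm]

lemma integral_sin_planaWeight_swap {s : ℝ} (hs : 0 < s) :
    ∫ x in Ioi (0 : ℝ), x ^ (s - 1) * Real.exp (-x) *
        ∫ t in Ioi (0 : ℝ), Real.sin (x * t) * planaWeight t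
      = Real.Gamma s *
        ∫ t in Ioi (0 : ℝ), ((1 - t * Complex.I) ^ (-(s : ℂ))).im * planaWeight t := by
  have hint : Integrable (Function.uncurry fun x t : ℝ =>
      x ^ (s - 1) * Real.exp (-x) * (Real.sin (x * t) * planaWeight t))
      ((volume.restrict (Ioi 0)).prod (volume.restrict (Ioi 0))) := by
    have h1 := integrableOn_rpow_mul_exp_neg (s := s + 1) (by linarith) one_pos
    have h2 := integrableOn_pow_mul_planaWeight 0
    refine Integrable.mono' (h1.mul_prod h2) ?_ ?_
    · have := measurable_planaWeight
      refine Measurable.aestronglyMeasurable ?_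
      unfold Function.uncurry
      fun_prop
    · rw [Measure.prod_restrict]
      filter_upwards [ae_restrict_mem (measurableSet_Ioi.prod measurableSet_Ioi)] with p hp
      obtain ⟨hx : 0 < p.1, ht : 0 < p.2⟩ := hp
      have h3 : |Real.sin (p.1 * p.2)| ≤ p.1 * p.2 :=
        Real.abs_sin_le_abs.trans (abs_of_pos (by positivity)).le
      have hw := planaWeight_nonneg ht
      simp only [Function.uncurry, norm_mul, Real.norm_eq_abs, abs_of_nonneg hw, Real.abs_exp,
        abs_of_nonneg (Real.rpow_nonneg hx.le _), add_sub_cancel_right, one_mul]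
      calc _ ≤ p.1 ^ (s - 1) * Real.exp (-p.1) * (p.1 * p.2 * planaWeight p.2) := by gcongr
        _ = p.1 ^ (s - 1) * p.1 * Real.exp (-p.1) * (p.2 ^ (0 + 1) * planaWeight p.2) := by ring
        _ = _ := by rw [← Real.rpow_add_one hx.ne', sub_add_cancel]
  simp only [← integral_const_mul]
  rw [integral_integral_swap hint]
  refine setIntegral_congr_fun measurableSet_Ioi fun t _ => ?_
  rw [← mul_assoc, ← integral_rpow_mul_exp_neg_mul_sin hs, ← integral_mul_const]
  simp only [mul_assoc]

/-- The extra factor `e^(-x)` starts the exponential series at `e^(-2x)`, so the Mellin transform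
misses the first term of the zeta series; hence the `-1`. -/
lemma integral_rpow_mul_exp_neg_div_exp_sub_one {s : ℝ} (hs : 1 < s) :
    ((∫ x in Ioi (0 : ℝ), x ^ (s - 1) * (Real.exp (-x) * (Real.exp x - 1)⁻¹) : ℝ) : ℂ)
      = Real.Gamma s * (riemannZeta s - 1) := by
  have hs0 : 0 < s := by linarith
  have hz := zeta_eq_tsum_one_div_nat_add_one_cpow (s := s) (by simpa using hs)
  have hsum : Summable fun n : ℕ => 1 / ((n : ℂ) + 1) ^ (s : ℂ) := by
    have := (Complex.summable_one_div_nat_cpow (p := s)).2 (by simpa using hs)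
    simpa using (summable_nat_add_iff 1).2 this
  have hz1 := hsum.hasSum
  rw [← hz, ← hasSum_nat_add_iff' 1] at hz1
  simp only [Finset.range_one, Finset.sum_singleton, Nat.cast_zero, zero_add, Complex.one_cpow,
    div_one, Nat.cast_add, Nat.cast_one] at hz1
  have hr : Summable fun i : ℕ => ‖(1 : ℂ)‖ / ((i : ℝ) + 2) ^ (s : ℂ).re := by
    have h := (summable_nat_add_iff 2).2 (Real.summable_one_div_nat_rpow.2 hs)
    simpa using h
  have h := hasSum_mellin (a := fun _ : ℕ => (1 : ℂ)) (p := fun i => (i : ℝ) + 2)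
    (F := fun x => ((Real.exp (-x) * (Real.exp x - 1)⁻¹ : ℝ) : ℂ)) (s := s)
    (fun i => Or.inr (by positivity)) (by simpa using hs0)
    (fun x hx => by
      have h1 := Complex.hasSum_ofReal.2 ((hasSum_exp_neg_mul hx).mul_left (Real.exp (-x)))
      refine h1.congr_fun fun i => ?_
      rw [← Real.exp_add, one_mul]
      congr 2
      ring) hr
  have h2 := h.unique ((hz1.mul_left (Complex.Gamma s)).congr_fun fun i => by
    push_cast
    rw [show (i : ℂ) + 1 + 1 = i + 2 by ring]
    ring)
  rw [← Complex.Gamma_ofReal, ← h2, mellin, ← integral_complex_ofReal]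
  refine setIntegral_congr_fun measurableSet_Ioi fun x hx => ?_
  simp only [smul_eq_mul]
  rw [Complex.ofReal_mul, Complex.ofReal_cpow (le_of_lt hx)]
  push_cast; rfl

/-- Hermite's formula for `ζ(s)`, for real `s > 1`. -/
lemma riemannZeta_eq_hermite {s : ℝ} (hs : 1 < s) :
    riemannZeta s = ((1 / (s - 1) + 1 / 2
      + 2 * ∫ t in Ioi (0 : ℝ), ((1 - t * Complex.I) ^ (-(s : ℂ))).im * planaWeight t : ℝ) : ℂ) := by
  have hs0 : 0 < s := by linarith
  have hG := (Real.Gamma_pos_of_pos hs0).ne'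
  have hGs : Real.Gamma s = (s - 1) * Real.Gamma (s - 1) := by
    have := Real.Gamma_add_one (s := s - 1) (by linarith)
    rwa [sub_add_cancel] at this
  have h1 := integrableOn_rpow_mul_exp_neg (s := s - 1) (by linarith) one_pos
  have h2 := integrableOn_rpow_mul_exp_neg hs0 one_pos
  have e1 := Real.integral_rpow_mul_exp_neg_mul_Ioi (a := s - 1) (by linarith) one_pos
  have e2 := Real.integral_rpow_mul_exp_neg_mul_Ioi hs0 one_pos
  simp only [one_mul, div_one, Real.one_rpow] at h1 h2 e1 e2
  -- Legendre's integral times `x^(s-1) e^(-x)`: the three pieces integrate to `Γ(s)(ζ(s)-1)`,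
  -- `Γ(s-1)` and `Γ(s)`.
  have hL : ∀ x ∈ Ioi (0 : ℝ), x ^ (s - 1) * Real.exp (-x) *
        ∫ t in Ioi (0 : ℝ), Real.sin (x * t) * planaWeight t
      = 2⁻¹ * (x ^ (s - 1) * (Real.exp (-x) * (Real.exp x - 1)⁻¹)
        - x ^ (s - 1 - 1) * Real.exp (-x) + 2⁻¹ * (x ^ (s - 1) * Real.exp (-x))) := by
    intro x hx
    have h := two_mul_integral_sin_mul_planaWeight hx
    rw [Real.rpow_sub_one (ne_of_gt hx) (s - 1)]
    linear_combination (2⁻¹ * x ^ (s - 1) * Real.exp (-x)) * h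
  have h3 : IntegrableOn
      (fun x : ℝ => x ^ (s - 1) * (Real.exp (-x) * (Real.exp x - 1)⁻¹)) (Ioi 0) := by
    refine Integrable.mono' h1 (Measurable.aestronglyMeasurable (by fun_prop)) ?_
    filter_upwards [ae_restrict_mem measurableSet_Ioi] with x hx
    have hx : 0 < x := hx
    have h5 : x ≤ Real.exp x - 1 := by linarith [Real.add_one_le_exp x]
    have h6 : (Real.exp x - 1)⁻¹ ≤ x⁻¹ := by gcongr
    have h7 : 0 ≤ (Real.exp x - 1)⁻¹ := inv_nonneg.2 (hx.le.trans h5)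
    rw [Real.norm_of_nonneg (by positivity), Real.rpow_sub_one hx.ne' (s - 1)]
    calc _ ≤ x ^ (s - 1) * (Real.exp (-x) * x⁻¹) := by gcongr
      _ = _ := by ring
  have h4 : IntegrableOn (fun x : ℝ => x ^ (s - 1) * (Real.exp (-x) * (Real.exp x - 1)⁻¹)
      - x ^ (s - 1 - 1) * Real.exp (-x)) (Ioi 0) := h3.sub h1
  have hsw := integral_sin_planaWeight_swap hs0
  rw [setIntegral_congr_fun measurableSet_Ioi hL, integral_const_mul,
    integral_add h4 (h2.const_mul _), integral_sub h3 h1, integral_const_mul, e1, e2]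
    at hsw
  have hz := integral_rpow_mul_exp_neg_div_exp_sub_one hs
  set A := ∫ x in Ioi (0 : ℝ), x ^ (s - 1) * (Real.exp (-x) * (Real.exp x - 1)⁻¹)
  set H := ∫ t in Ioi (0 : ℝ), ((1 - t * Complex.I) ^ (-(s : ℂ))).im * planaWeight t
  have hGc : (Real.Gamma s : ℂ) ≠ 0 := by exact_mod_cast hG
  have hA : A = Real.Gamma s * (1 / (s - 1) + 1 / 2 + 2 * H - 1) := by
    have : s - 1 ≠ 0 := by linarith
    have h8 : Real.Gamma s * (1 / (s - 1)) = Real.Gamma (s - 1) := by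
      rw [hGs]; field_simp
    linear_combination 2 * hsw - h8
  rw [hA] at hz
  push_cast at hz
  have := mul_left_cancel₀ hGc hz
  push_cast
  linear_combination -this

/-! ### Maclaurin coefficients and analytic continuation to the disc -/

/-- The `n`-th Maclaurin coefficient of `ζ(s) - 1 / (s - 1) - 1 / 2`, as an integral. -/
noncomputable def zetaCoeff (n : ℕ) : ℝ :=
  2 * ∫ t in Ioi (0 : ℝ), (logPow n t).im * planaWeight t

lemma zetaCoeff_zero : zetaCoeff 0 = 0 := by simp [zetaCoeff, logPow_zero]

lemma continuous_logPow_im (n : ℕ) : Continuous fun t => (logPow n t).im :=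
  Complex.continuous_im.comp (continuous_logPow n)

lemma abs_logPow_succ_im_le (n : ℕ) (t : ℝ) (ht : 0 < t) :
    |(logPow (n + 1) t).im| ≤ 1 / (n + 1).factorial * t ^ (n + 1) :=
  (Complex.abs_im_le_norm _).trans ((norm_logPow_le (n + 1) ht.le).trans (by rw [one_div_mul_eq_div]))

lemma integrableOn_logPow_im (n : ℕ) :
    IntegrableOn (fun t => (logPow n t).im * planaWeight t) (Ioi 0) := by
  cases n with
  | zero => simp [logPow_zero]
  | succ n => exact integrableOn_mul_planaWeight (continuous_logPow_im _) (abs_logPow_succ_im_le n)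

lemma integral_abs_logPow_im_le (n : ℕ) :
    ∫ t in Ioi (0 : ℝ), |(logPow n t).im * planaWeight t| ≤ (1 / 3) ^ n := by
  cases n with
  | zero => simp [logPow_zero]
  | succ n =>
    refine (integral_abs_mul_planaWeight_le (continuous_logPow_im _)
      (abs_logPow_succ_im_le n)).trans ?_
    rw [Nat.factorial_succ, one_div_pow, div_mul_div_comm, one_mul]
    have h : (0 : ℝ) < n.factorial := by exact_mod_cast n.factorial_pos
    push_cast
    rw [div_le_div_iff₀ (by positivity) (by positivity)]
    have h3 : (0 : ℝ) ≤ n * n.factorial * 3 ^ (n + 1) := by positivity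
    linarith

lemma abs_zetaCoeff_le (n : ℕ) : |zetaCoeff n| ≤ 2 * (1 / 3) ^ n := by
  rw [zetaCoeff, abs_mul, abs_two]
  have := (abs_integral_le_integral_abs (f := fun t => (logPow n t).im * planaWeight t)
    (μ := volume.restrict (Ioi 0))).trans (integral_abs_logPow_im_le n)
  linarith

lemma hasSum_zetaCoeff_real {s : ℝ} (hs : |s| < 3) :
    HasSum (fun n => zetaCoeff n * s ^ n)
      (2 * ∫ t in Ioi (0 : ℝ), ((1 - t * Complex.I) ^ (-(s : ℂ))).im * planaWeight t) := by
  -- Since `s` is real, taking imaginary parts commutes with multiplication by `s ^ n`; the `3^(-n)`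
  -- bound justifies the interchange for `|s| < 3`.
  have h := hasSum_integral_of_summable_integral_norm
    (F := fun n t => (logPow n t).im * planaWeight t * s ^ n)
    (μ := volume.restrict (Ioi 0)) (fun n => (integrableOn_logPow_im n).mul_const _) ?_
  · convert! h.mul_left 2 using 1
    · funext n
      rw [zetaCoeff, integral_mul_const, mul_assoc]
    · congr 1
      refine integral_congr_ae (Eventually.of_forall fun t => ?_)
      refine HasSum.tsum_eq ?_ |>.symm
      have h1 := (Complex.hasSum_im (hasSum_logPow t s)).mul_right (planaWeight t)
      refine h1.congr_fun fun n => ?_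
      rw [← Complex.ofReal_pow, Complex.im_mul_ofReal]
      ring
  · refine Summable.of_nonneg_of_le (fun n => integral_nonneg fun t => norm_nonneg _)
      (fun n => ?_) (summable_geometric_of_lt_one (r := |s| / 3) (by positivity) (by linarith))
    simp only [norm_mul _ (s ^ n)]
    rw [integral_mul_const, div_pow, norm_pow, Real.norm_eq_abs s]
    have h2 := mul_le_mul_of_nonneg_right (integral_abs_logPow_im_le n) (pow_nonneg (abs_nonneg s) n)
    simp only [Real.norm_eq_abs] at h2 ⊢
    refine h2.trans (le_of_eq ?_)
    rw [one_div_pow]; ring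

lemma norm_zetaCoeff_mul_pow_le (n : ℕ) {s : ℂ} (hs : s ∈ Metric.ball (0 : ℂ) 2) :
    ‖(zetaCoeff n : ℂ) * s ^ n‖ ≤ 2 * (2 / 3) ^ n := by
  rw [mem_ball_zero_iff] at hs
  rw [norm_mul, norm_pow, Complex.norm_real, Real.norm_eq_abs]
  calc |zetaCoeff n| * ‖s‖ ^ n ≤ 2 * (1 / 3) ^ n * 2 ^ n := by
        gcongr
        exact abs_zetaCoeff_le n
    _ = 2 * (2 / 3) ^ n := by rw [mul_assoc, ← mul_pow]; norm_num

lemma summable_two_mul_geometric : Summable fun n : ℕ => (2 : ℝ) * (2 / 3) ^ n :=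
  (summable_geometric_of_lt_one (by norm_num) (by norm_num)).mul_left 2

lemma summable_zetaCoeff_mul_pow {s : ℂ} (hs : s ∈ Metric.ball (0 : ℂ) 2) :
    Summable fun n => (zetaCoeff n : ℂ) * s ^ n :=
  Summable.of_norm_bounded summable_two_mul_geometric fun n => norm_zetaCoeff_mul_pow_le n hs

lemma differentiableOn_tsum_zetaCoeff :
    DifferentiableOn ℂ (fun s : ℂ => ∑' n, (zetaCoeff n : ℂ) * s ^ n) (Metric.ball 0 2) :=
  Complex.differentiableOn_tsum_of_summable_norm summable_two_mul_geometric
    (fun n => by fun_prop) Metric.isOpen_ball fun n _ hs => norm_zetaCoeff_mul_pow_le n hs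

/-- Radius `2` leaves room for the real interval `(1, 2)`, where Hermite's formula is available.
Multiplying by `s - 1` removes the pole, and the identity theorem carries the equality over the
whole disc. -/
lemma sub_one_mul_riemannZeta_eq {s : ℂ} (hs : s ∈ Metric.ball (0 : ℂ) 2) (h1 : s ≠ 1) :
    (s - 1) * riemannZeta s = 1 + (s - 1) * (1 / 2 + ∑' n, (zetaCoeff n : ℂ) * s ^ n) := by
  -- The value `1` at `s = 1` is the residue of `ζ`, which makes `F` continuous there and the
  -- singularity removable.
  set F : ℂ → ℂ := Function.update (fun s => (s - 1) * riemannZeta s) 1 1 with hF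
  have hFne : ∀ z : ℂ, z ≠ 1 → F z = (z - 1) * riemannZeta z := fun z hz =>
    Function.update_of_ne hz _ _
  have hball : Metric.ball (0 : ℂ) 2 ∈ 𝓝 (1 : ℂ) :=
    Metric.isOpen_ball.mem_nhds (by simp)
  have hd : DifferentiableOn ℂ F (Metric.ball 0 2) := by
    refine (Complex.differentiableOn_compl_singleton_and_continuousAt_iff hball).1 ⟨?_, ?_⟩
    · intro z hz
      have hz1 : z ≠ 1 := hz.2
      have : DifferentiableAt ℂ (fun s => (s - 1) * riemannZeta s) z :=
        (by fun_prop : DifferentiableAt ℂ (fun s : ℂ => s - 1) z).mul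
          (differentiableAt_riemannZeta hz1)
      refine (this.congr_of_eventuallyEq ?_).differentiableWithinAt
      filter_upwards [isOpen_ne.mem_nhds hz1] with w hw using hFne w hw
    · exact continuousAt_update_same.2 riemannZeta_residue_one
  have hg : DifferentiableOn ℂ
      (fun s : ℂ => 1 + (s - 1) * (1 / 2 + ∑' n, (zetaCoeff n : ℂ) * s ^ n))
      (Metric.ball 0 2) := by
    have := differentiableOn_tsum_zetaCoeff
    fun_prop
  have hreal : ∀ u : ℝ, 1 < u → u < 2 →
      F u = 1 + ((u : ℂ) - 1) * (1 / 2 + ∑' n, (zetaCoeff n : ℂ) * (u : ℂ) ^ n) := by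
    intro u hu1 hu2
    have hne : (u : ℂ) ≠ 1 := by exact_mod_cast hu1.ne'
    have h := hasSum_zetaCoeff_real (s := u) (by rw [abs_of_pos] <;> linarith)
    have h' := (Complex.hasSum_ofReal.2 h).tsum_eq
    simp only [Complex.ofReal_mul _ (_ ^ _), Complex.ofReal_pow] at h'
    rw [hFne _ hne, riemannZeta_eq_hermite hu1, h']
    have : (u : ℂ) - 1 ≠ 0 := sub_ne_zero.2 hne
    generalize (∫ t in Ioi (0 : ℝ), _ : ℝ) = H
    push_cast
    field_simp
    ring
  have h32 : ((3 / 2 : ℝ) : ℂ) ∈ Metric.ball (0 : ℂ) 2 := by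
    rw [mem_ball_zero_iff, Complex.norm_real]
    norm_num
  have hfreq : ∃ᶠ z in 𝓝[≠] ((3 / 2 : ℝ) : ℂ),
      F z = 1 + (z - 1) * (1 / 2 + ∑' n, (zetaCoeff n : ℂ) * z ^ n) := by
    have ht : Tendsto (fun u : ℝ => (u : ℂ)) (𝓝[≠] (3 / 2 : ℝ)) (𝓝[≠] ((3 / 2 : ℝ) : ℂ)) := by
      refine tendsto_nhdsWithin_iff.2
        ⟨(Complex.continuous_ofReal.tendsto _).mono_left nhdsWithin_le_nhds, ?_⟩
      filter_upwards [self_mem_nhdsWithin] with u hu h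
      exact hu (Complex.ofReal_injective h)
    refine ht.frequently (Eventually.frequently ?_)
    filter_upwards [nhdsWithin_le_nhds (Ioo_mem_nhds (show (1 : ℝ) < 3 / 2 by norm_num)
      (show (3 / 2 : ℝ) < 2 by norm_num))] with u hu using hreal u hu.1 hu.2
  have := (hd.analyticOnNhd Metric.isOpen_ball).eqOn_of_preconnected_of_frequently_eq
    (hg.analyticOnNhd Metric.isOpen_ball) (convex_ball 0 2).isPreconnected h32 hfreq hs
  rw [← hFne s h1]
  exact this

/-- The value of the semi-convergent series for the `n`-th coefficient. -/
noncomputable def zetaSeriesValue (n : ℕ) : ℝ := zetaCoeff n + if n = 0 then 1 / 2 else 0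

lemma isZetaMaclaurin_zetaSeriesValue :
    IsZetaMaclaurin fun n => -1 + (zetaSeriesValue n : ℂ) := by
  intro s hs
  have hb : s ∈ Metric.ball (0 : ℂ) 2 := by
    rw [mem_ball_zero_iff]; linarith
  have h1 : s ≠ 1 := by rintro rfl; simp at hs
  have hne : s - 1 ≠ 0 := sub_ne_zero.2 h1
  have hne' : 1 - s ≠ 0 := sub_ne_zero.2 h1.symm
  have h := sub_one_mul_riemannZeta_eq hb h1
  have hz : riemannZeta s = -(1 - s)⁻¹ + (∑' n, (zetaCoeff n : ℂ) * s ^ n + 1 / 2) := by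
    apply mul_left_cancel₀ hne
    rw [h]
    field_simp
    ring
  rw [hz]
  have hhalf : HasSum (fun n : ℕ => (if n = 0 then 1 / 2 else 0 : ℂ)) (1 / 2) :=
    hasSum_ite_eq 0 (1 / 2 : ℂ)
  refine (((hasSum_geometric_of_norm_lt_one hs).neg).add
    ((summable_zetaCoeff_mul_pow hb).hasSum.add hhalf)).congr_fun fun n => ?_
  rcases eq_or_ne n 0 with rfl | hn
  · simp [zetaSeriesValue]
  · simp [zetaSeriesValue, hn]
    ring

lemma IsZetaMaclaurin.hasFPowerSeriesAt {c : ℕ → ℂ} (hc : IsZetaMaclaurin c) :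
    HasFPowerSeriesAt riemannZeta (FormalMultilinearSeries.ofScalars ℂ c) 0 := by
  rw [hasFPowerSeriesAt_iff]
  filter_upwards [Metric.ball_mem_nhds (0 : ℂ) one_pos] with z hz
  rw [mem_ball_zero_iff] at hz
  simpa [FormalMultilinearSeries.coeff_ofScalars, mul_comm] using hc z hz

lemma IsZetaMaclaurin.unique {c d : ℕ → ℂ} (hc : IsZetaMaclaurin c) (hd : IsZetaMaclaurin d) :
    c = d := by
  have h := hc.hasFPowerSeriesAt.eq_formalMultilinearSeries hd.hasFPowerSeriesAt
  funext n
  simpa [FormalMultilinearSeries.coeff_ofScalars] using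
    congrArg (fun p : FormalMultilinearSeries ℂ ℂ ℂ => p.coeff n) h

/-! ### Terms and truncation errors as integrals -/

lemma zetaTerm_zero_zero : zetaTerm 0 0 = 1 / 2 := by
  norm_num [zetaTerm, bernoulli_one]

lemma zetaTerm_eq_zero_of_even {n k : ℕ} (hk : Even k) (hk0 : k ≠ 0) : zetaTerm n k = 0 := by
  simp [zetaTerm, bernoulli_eq_zero_of_odd hk.add_one (by omega)]

lemma I_pow_two_mul_add_one_im (j : ℕ) : (Complex.I ^ (2 * j + 1)).im = (-1) ^ j := by
  rw [pow_succ, pow_mul, Complex.I_sq]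
  have : ((-1 : ℂ)) ^ j = (((-1 : ℝ) ^ j : ℝ) : ℂ) := by push_cast; rfl
  rw [this, Complex.im_ofReal_mul, Complex.I_im, mul_one]

lemma zetaTerm_odd (n j : ℕ) :
    zetaTerm n (2 * j + 1) = 2 * (stirlingCoeff n (2 * j + 1) * (-1) ^ j)
      * ∫ t in Ioi (0 : ℝ), t ^ (2 * j + 1) * planaWeight t := by
  have h := integral_pow_mul_planaWeight j.succ_ne_zero
  rw [show 2 * j.succ - 1 = 2 * j + 1 by omega] at h
  rw [h, zetaTerm, stirlingCoeff, Nat.factorial_succ (2 * j + 1),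
    show 2 * j + 1 + 1 = 2 * j.succ by omega]
  have h1 : ((2 * j + 1).factorial : ℝ) ≠ 0 := by exact_mod_cast Nat.factorial_ne_zero _
  have h2 : ((-1 : ℝ) ^ j) ^ 2 = 1 := by rw [← pow_mul, mul_comm, pow_mul]; norm_num
  have h3 : (-1 : ℝ) ^ (2 * j.succ) = 1 := by rw [pow_mul]; norm_num
  rw [h3, show j.succ + 1 = j + 2 by omega, pow_add]
  have h4 : (j : ℝ) + 1 ≠ 0 := by positivity
  push_cast
  field_simp
  rw [h2]
  ring

/-- For even `k` both sides vanish: `B_{k+1} = 0` and `i^k` is real. At `k = 0` this fails because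
`B_1 ≠ 0`. -/
lemma zetaTerm_eq_integral (n : ℕ) {k : ℕ} (hk : k ≠ 0) :
    zetaTerm n k = 2 * ∫ t in Ioi (0 : ℝ),
      ((stirlingCoeff n k : ℂ) * (t * Complex.I) ^ k).im * planaWeight t := by
  have him : ∀ t : ℝ, ((stirlingCoeff n k : ℂ) * (t * Complex.I) ^ k).im
      = stirlingCoeff n k * (Complex.I ^ k).im * t ^ k := fun t => by
    rw [mul_pow, ← Complex.ofReal_pow, Complex.im_ofReal_mul, Complex.im_ofReal_mul]
    ring
  simp only [him, mul_assoc _ (_ ^ k) (planaWeight _)]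
  rw [integral_const_mul, ← mul_assoc]
  rcases Nat.even_or_odd' k with ⟨j, rfl | rfl⟩
  · rw [zetaTerm_eq_zero_of_even (even_two_mul j) hk, pow_mul, Complex.I_sq]
    have : ((-1 : ℂ)) ^ j = (((-1 : ℝ) ^ j : ℝ) : ℂ) := by push_cast; rfl
    rw [this, Complex.ofReal_im]
    simp
  · rw [I_pow_two_mul_add_one_im, zetaTerm_odd]

lemma continuous_logPowRem_im (n M : ℕ) : Continuous fun t => (logPowRem n M t).im :=
  Complex.continuous_im.comp (continuous_logPowRem n M)

lemma abs_logPowRem_succ_im_le {n M : ℕ} (h : n ≤ M + 1) (t : ℝ) (ht : 0 < t) :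
    |(logPowRem n (M + 1) t).im| ≤ stirlingCoeff n (M + 1) * t ^ (M + 1) :=
  (Complex.abs_im_le_norm _).trans (norm_logPowRem_le h ht.le)

lemma integrableOn_logPowRem_im {n M : ℕ} (hM : M ≠ 0) (h : n ≤ M) :
    IntegrableOn (fun t => (logPowRem n M t).im * planaWeight t) (Ioi 0) := by
  obtain ⟨M, rfl⟩ := Nat.exists_eq_succ_of_ne_zero hM
  exact integrableOn_mul_planaWeight (continuous_logPowRem_im _ _) (abs_logPowRem_succ_im_le h)

lemma logPowRem_self (n : ℕ) (t : ℝ) : logPowRem n n t = logPow n t := by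
  rw [logPowRem, Finset.sum_eq_zero, sub_zero]
  intro k hk
  simp [stirlingCoeff_eq_zero (Finset.mem_range.1 hk)]

/-- The error of the truncated series, as an integral. -/
lemma zetaCoeff_sub_sum {n N : ℕ} (hn : n ≠ 0) (h : n ≤ N) :
    zetaCoeff n - ∑ k ∈ Finset.Ico n N, zetaTerm n k
      = 2 * ∫ t in Ioi (0 : ℝ), (logPowRem n N t).im * planaWeight t := by
  induction N, h using Nat.le_induction with
  | base => simp [zetaCoeff, logPowRem_self]
  | succ N hN ih =>
    rw [Finset.sum_Ico_succ_top hN, ← sub_sub, ih, zetaTerm_eq_integral n (by omega), ← mul_sub]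
    congr 1
    have hrem : ∀ t : ℝ, ((stirlingCoeff n N : ℂ) * (t * Complex.I) ^ N).im * planaWeight t
        = (logPowRem n N t).im * planaWeight t - (logPowRem n (N + 1) t).im * planaWeight t := by
      intro t
      rw [← sub_mul, ← Complex.sub_im, logPowRem, logPowRem, Finset.sum_range_succ]
      congr 2
      ring
    simp only [hrem]
    rw [integral_sub (integrableOn_logPowRem_im (by omega) hN)
      (integrableOn_logPowRem_im (by omega) (by omega)), sub_sub_cancel]

lemma integral_pow_mul_planaWeight_nonneg (k : ℕ) :
    0 ≤ ∫ t in Ioi (0 : ℝ), t ^ k * planaWeight t :=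
  setIntegral_nonneg measurableSet_Ioi fun t (ht : 0 < t) =>
    mul_nonneg (pow_nonneg ht.le _) (planaWeight_nonneg ht)

lemma abs_zetaCoeff_sub_sum_le {n j : ℕ} (hn : n ≠ 0) (h : n ≤ 2 * j + 1) :
    |zetaCoeff n - ∑ k ∈ Finset.Ico n (2 * j + 1), zetaTerm n k| ≤ |zetaTerm n (2 * j + 1)| := by
  rw [zetaCoeff_sub_sum hn h, zetaTerm_odd, abs_mul, abs_mul, abs_mul, abs_mul, abs_two, abs_pow,
    abs_neg, abs_one, one_pow, mul_one, abs_of_nonneg (stirlingCoeff_nonneg _ _),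
    abs_of_nonneg (integral_pow_mul_planaWeight_nonneg _), mul_assoc]
  gcongr
  exact abs_integral_mul_planaWeight_le (continuous_logPowRem_im _ _) (abs_logPowRem_succ_im_le h)

lemma zetaTerm_mul_zetaTerm_nonpos (n j : ℕ) :
    zetaTerm n (2 * j + 1) * zetaTerm n (2 * (j + 1) + 1) ≤ 0 := by
  rw [zetaTerm_odd, zetaTerm_odd]
  have h1 := stirlingCoeff_nonneg n (2 * j + 1)
  have h2 := stirlingCoeff_nonneg n (2 * (j + 1) + 1)
  have h3 := integral_pow_mul_planaWeight_nonneg (2 * j + 1)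
  have h4 := integral_pow_mul_planaWeight_nonneg (2 * (j + 1) + 1)
  generalize (∫ t in Ioi (0 : ℝ), t ^ (2 * j + 1) * planaWeight t) = A at *
  generalize (∫ t in Ioi (0 : ℝ), t ^ (2 * (j + 1) + 1) * planaWeight t) = B at *
  generalize stirlingCoeff n (2 * j + 1) = a at *
  generalize stirlingCoeff n (2 * (j + 1) + 1) = b at *
  have h5 : ((-1 : ℝ) ^ j) ^ 2 = 1 := by rw [← pow_mul, mul_comm, pow_mul]; norm_num
  have h6 : 0 ≤ a * b * A * B := by positivity
  linear_combination 4 * h6 - (4 * a * b * A * B) * h5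

/-! ### Signs of the errors and semi-convergence -/

/-- If `e = e' - t'` with `|e'| ≤ |t'|`, and `|e| ≤ |t|` with `t`, `t'` of opposite signs, then
`e` lies between `0` and `t`. -/
lemma exists_mem_Icc_eq_mul {e e' t t' : ℝ} (h : e = e' - t') (h' : |e'| ≤ |t'|)
    (he : |e| ≤ |t|) (ht : t' * t ≤ 0) : ∃ θ ∈ Icc (0 : ℝ) 1, e = θ * t := by
  rcases eq_or_ne t 0 with rfl | h0
  · exact ⟨0, ⟨le_rfl, zero_le_one⟩, by simpa using he⟩
  rcases eq_or_ne t' 0 with rfl | h0'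
  · refine ⟨0, ⟨le_rfl, zero_le_one⟩, ?_⟩
    have : e' = 0 := by simpa using h'
    simp [h, this]
  refine ⟨e / t, ⟨?_, ?_⟩, (div_mul_cancel₀ _ h0).symm⟩
  · rcases h0'.lt_or_gt with hneg | hpos
    · have := nonneg_of_mul_nonpos_right ht hneg
      refine div_nonneg ?_ this
      rw [abs_of_neg hneg] at h'
      linarith [neg_le_of_abs_le h']
    · have := nonpos_of_mul_nonpos_right ht hpos
      refine div_nonneg_of_nonpos ?_ this
      rw [abs_of_pos hpos] at h'
      linarith [le_of_abs_le h']
  · refine (le_abs_self _).trans ?_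
    rw [abs_div]
    exact div_le_one_of_le₀ he (abs_nonneg _)

/-- Only the term `k = 0` is nonzero; it equals the `1/2` of Hermite's formula, so every later error
is exactly zero. -/
lemma semiconvergesTo_zetaTerm_zero : SemiconvergesTo (zetaTerm 0) 0 (zetaSeriesValue 0) := by
  have hzero : ∀ k, k ≠ 0 → zetaTerm 0 k = 0 := fun k hk => by
    obtain ⟨j, rfl⟩ := Nat.exists_eq_succ_of_ne_zero hk
    simp [zetaTerm]
  intro N _
  refine ⟨N, le_rfl, by simp, ?_⟩
  rcases Nat.eq_zero_or_pos N with rfl | hN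
  · simp [zetaSeriesValue, zetaCoeff_zero, zetaTerm_zero_zero]
  · have hsum : zetaSeriesValue 0 - ∑ k ∈ Finset.Ico 0 N, zetaTerm 0 k = 0 := by
      rw [Finset.sum_eq_single 0 (fun k _ hk => hzero k hk) (fun h => absurd (by simpa using hN) h),
        zetaTerm_zero_zero]
      simp [zetaSeriesValue, zetaCoeff_zero]
    rw [hsum]
    exact ⟨by simp, fun _ => ⟨0, by simp, by simp⟩⟩

lemma semiconvergesTo_zetaTerm {n : ℕ} (hn : n ≠ 0) :
    SemiconvergesTo (zetaTerm n) n (zetaSeriesValue n) := by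
  have hv : zetaSeriesValue n = zetaCoeff n := by simp [zetaSeriesValue, hn]
  rw [hv]
  intro N hN
  -- `2 * j + 1` is the least odd index not below `N`; any even index skipped carries a zero term.
  obtain ⟨j, hj, hj'⟩ : ∃ j, N ≤ 2 * j + 1 ∧ 2 * j ≤ N := ⟨N / 2, by omega, by omega⟩
  have hzero : ∀ k ∈ Finset.Ico N (2 * j + 1), zetaTerm n k = 0 := fun k hk => by
    rw [Finset.mem_Ico] at hk
    exact zetaTerm_eq_zero_of_even ⟨j, by omega⟩ (by omega)
  have hsum : ∑ k ∈ Finset.Ico n N, zetaTerm n k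
      = ∑ k ∈ Finset.Ico n (2 * j + 1), zetaTerm n k := by
    rw [← Finset.sum_Ico_consecutive _ hN hj, Finset.sum_eq_zero hzero, add_zero]
  refine ⟨2 * j + 1, hj, hzero, ?_, ?_⟩
  · rw [hsum]
    exact abs_zetaCoeff_sub_sum_le hn (hN.trans hj)
  · rintro ⟨k, hk, hk0⟩
    rw [Finset.mem_Ico] at hk
    have hodd : ¬ Even k := fun he => hk0 (zetaTerm_eq_zero_of_even he (by omega))
    rw [Nat.not_even_iff_odd] at hodd
    obtain ⟨i, rfl⟩ := hodd
    -- The retained nonzero term has odd index at least `n` and below `2 * j + 1`. Hence the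
    -- preceding odd index `2 * l + 1` is also at least `n`, and the error bound is available there
    -- too.
    obtain ⟨l, rfl⟩ : ∃ l, j = l + 1 := ⟨j - 1, by omega⟩
    rw [hsum]
    refine exists_mem_Icc_eq_mul ?_ (abs_zetaCoeff_sub_sum_le (j := l) hn (by omega))
      (abs_zetaCoeff_sub_sum_le hn (hN.trans hj)) (zetaTerm_mul_zetaTerm_nonpos n l)
    rw [show 2 * (l + 1) + 1 = 2 * l + 1 + 1 + 1 by ring, Finset.sum_Ico_succ_top (by omega),
      Finset.sum_Ico_succ_top (by omega),
      zetaTerm_eq_zero_of_even (k := 2 * l + 1 + 1) ⟨l + 1, by ring⟩ (by omega)]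
    ring

theorem mainTheorem2 :
    (∃ c : ℕ → ℂ, IsZetaMaclaurin c) ∧
    ∀ c : ℕ → ℂ, IsZetaMaclaurin c →
      ∀ n : ℕ, ∃ S : ℝ, c n = -1 + (S : ℂ) ∧ SemiconvergesTo (zetaTerm n) n S := by
  refine ⟨⟨_, isZetaMaclaurin_zetaSeriesValue⟩, fun c hc n => ⟨zetaSeriesValue n, ?_, ?_⟩⟩
  · rw [hc.unique isZetaMaclaurin_zetaSeriesValue]
  · rcases eq_or_ne n 0 with rfl | hn
    · exact semiconvergesTo_zetaTerm_zero
    · exact semiconvergesTo_zetaTerm hn
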